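/- Let $R$ be a commutative noetherian ring, let $n\ge 1$ be an integer, and let $M,N,K$ be finitely generated $R$-modules. Write $\operatorname{Tr}M$ for the Auslander transpose of $M$, that is, the cokernel of $P_0^*\to P_1^*$ for a presentation $P_1\to P_0\to M\to 0$ by finitely generated projective modules, where $(-)^*=\operatorname{Hom}_R(-,R)$; it is unique up to finitely generated projective direct summands. Assume that $M$ is $(n+1)$-torsionfree with respect to $K$, i.e. $\operatorname{Ext}^i_R(\operatorname{Tr}M,K)=0$ for all $1\le i\le n+1$. Assume also that for every prime ideal $\mathfrak p$ of $R$ such that neither $M_{\mathfrak p}$ nor $N_{\mathfrak p}$ is a free $R_{\mathfrak p}$-module one has $\operatorname{depth}_{R_{\mathfrak p}}K_{\mathfrak p}\ge n$ (the zero module has depth $\infty$). Let $\underline{\operatorname{Hom}}_R(M,N)$ be the stable Hom module, i.e. the quotient of $\operatorname{Hom}_R(M,N)$ by the submodule of the homomorphisms that factor through a (finitely generated) projective $R$-module. Then the following hold. (1) There exists an exact sequence of $R$-modules $$0\to \operatorname{Ext}^{n-1}_R(\operatorname{Hom}_R(M,N),K)\to \operatorname{Ext}^{n-1}_R(N,M\otimes_R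 K)\to \operatorname{Ext}^{n}_R(\underline{\operatorname{Hom}}_R(M,N),K)\to \operatorname{Ext}^{n}_R(\operatorname{Hom}_R(M,N),K).$$ (2) For all integers $i\le n-2$ there is an isomorphism of $R$-modules $$\operatorname{Ext}^i_R(\operatorname{Hom}_R(M,N),K)\cong \operatorname{Ext}^i_R(N,M\otimes_R K)$$ (where $\operatorname{Ext}^i_R=0$ for $i<0$). -/

import Mathlib

open CategoryTheory TensorProduct

universe u

namespace ARDuality

/-- The depth of a finitely generated module over a (noetherian) local ring: the supremum of the
lengths of the `M`-regular sequences in the maximal ideal. For `M ≠ 0` finitely generated the extra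
condition `M / (rs) M ≠ 0` in the definition of a regular sequence is automatic by Nakayama's lemma,
so it is not imposed; as a result the zero module has depth `⊤`, the usual convention. -/
noncomputable def depth (A M : Type*) [CommRing A] [IsLocalRing A] [AddCommGroup M] [Module A M] :
    ℕ∞ :=
  ⨆ (rs : List A) (_ : (∀ r ∈ rs, r ∈ IsLocalRing.maximalIdeal A) ∧
    RingTheory.Sequence.IsWeaklyRegular M rs), (rs.length : ℕ∞)

section

variable (R : Type u) [CommRing R]

/-- `NF(M)`: the set of primes `p` such that `M_p` is not free over `R_p`. -/
def nonfreeLocus (M : Type u) [AddCommGroup M] [Module R M] : Set (PrimeSpectrum R) :=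
  (Module.freeLocus R M)ᶜ

/-- `Y^n(K)`: the set of primes `p` such that the depth of `K_p` over `R_p` is at least `n`. -/
def depthGELocus (K : Type u) [AddCommGroup K] [Module R K] (n : ℕ) : Set (PrimeSpectrum R) :=
  {p | (n : ℕ∞) ≤ depth (Localization.AtPrime p.asIdeal)
    (LocalizedModule p.asIdeal.primeCompl K)}

/-- A presentation `P₁ → P₀ → M → 0` of `M` by finitely generated projective modules. -/
structure FinProjPresentation (M : Type u) [AddCommGroup M] [Module R M] where
  P₁ : Type u
  P₀ : Type u
  [addCommGroup₁ : AddCommGroup P₁]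
  [module₁ : Module R P₁]
  [finite₁ : Module.Finite R P₁]
  [projective₁ : Module.Projective R P₁]
  [addCommGroup₀ : AddCommGroup P₀]
  [module₀ : Module R P₀]
  [finite₀ : Module.Finite R P₀]
  [projective₀ : Module.Projective R P₀]
  d : P₁ →ₗ[R] P₀
  π : P₀ →ₗ[R] M
  exact : Function.Exact d π
  surjective : Function.Surjective π

attribute [instance] FinProjPresentation.addCommGroup₁ FinProjPresentation.module₁
  FinProjPresentation.finite₁ FinProjPresentation.projective₁
  FinProjPresentation.addCommGroup₀ FinProjPresentation.module₀
  FinProjPresentation.finite₀ FinProjPresentation.projective₀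

/-- Every finitely generated module over a noetherian ring has such a presentation. -/
theorem nonempty_finProjPresentation [IsNoetherianRing R] (M : Type u) [AddCommGroup M]
    [Module R M] [Module.Finite R M] : Nonempty (FinProjPresentation R M) := by
  obtain ⟨a, π, hπ⟩ := Module.Finite.exists_fin' R M
  obtain ⟨b, d, hd⟩ := Module.Finite.exists_fin' R (LinearMap.ker π)
  exact ⟨{ P₁ := Fin b → R, P₀ := Fin a → R, d := (LinearMap.ker π).subtype ∘ₗ d, π := π
           exact := by
             rw [LinearMap.exact_iff, LinearMap.range_comp, LinearMap.range_eq_top.2 hd,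
               Submodule.map_top, Submodule.range_subtype]
           surjective := hπ }⟩

variable {R} in
/-- The Auslander transpose `Tr M`, computed from the presentation `P₁ → P₀ → M → 0`: the cokernel
of the dual map `P₀^* → P₁^*`. -/
abbrev FinProjPresentation.transpose {M : Type u} [AddCommGroup M] [Module R M]
    (P : FinProjPresentation R M) : Type u :=
  Module.Dual R P.P₁ ⧸ LinearMap.range P.d.dualMap

/-- The `R`-module `Ext^i(X, Y)`. -/
abbrev ExtMod (i : ℕ) (X Y : Type u) [AddCommGroup X] [Module R X] [AddCommGroup Y] [Module R Y] :
    Type u :=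
  Abelian.Ext (ModuleCat.of R X) (ModuleCat.of R Y) i

/-- `M` is `n`-torsionfree with respect to `K`: `Ext^i(Tr M, K) = 0` for `1 ≤ i ≤ n`.
The transpose is determined by `M` up to finitely generated projective direct summands, so that
this does not depend on the presentation from which `Tr M` is computed. -/
def IsTorsionfreeWrt (n : ℕ) (M K : Type u) [AddCommGroup M] [Module R M]
    [AddCommGroup K] [Module R K] : Prop :=
  ∃ P : FinProjPresentation R M, ∀ i : ℕ, 1 ≤ i → i ≤ n →
    Subsingleton (ExtMod R i P.transpose K)

/-- The submodule of `Hom(M, N)` of the homomorphisms that factor through a (finitely generated)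
projective module. -/
def projectiveHom (M N : Type u) [AddCommGroup M] [Module R M] [AddCommGroup N] [Module R N] :
    Submodule R (M →ₗ[R] N) where
  carrier := {f | ∃ (P : Type u) (_ : AddCommGroup P) (_ : Module R P),
    Module.Finite R P ∧ Module.Projective R P ∧
      ∃ (g : M →ₗ[R] P) (h : P →ₗ[R] N), f = h ∘ₗ g}
  zero_mem' := ⟨PUnit, inferInstance, inferInstance, inferInstance, inferInstance, 0, 0, by simp⟩
  add_mem' := by
    rintro _ _ ⟨P, _, _, _, _, g, h, rfl⟩ ⟨Q, _, _, _, _, g', h', rfl⟩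
    exact ⟨P × Q, inferInstance, inferInstance, inferInstance, inferInstance,
      g.prod g', h.coprod h', by ext; simp⟩
  smul_mem' := by
    rintro c _ ⟨P, _, _, _, _, g, h, rfl⟩
    exact ⟨P, inferInstance, inferInstance, inferInstance, inferInstance, g, c • h,
      by ext; simp⟩

/-- The stable Hom module: `Hom(M, N)` modulo the homomorphisms factoring through projectives. -/
abbrev StableHom (M N : Type u) [AddCommGroup M] [Module R M] [AddCommGroup N] [Module R N] :
    Type u :=
  (M →ₗ[R] N) ⧸ projectiveHom R M N

end

end ARDuality

/-! Write `I(M, N)` for `projectiveHom R M N`. The theorem is read off the long exact sequence of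
`Ext(-, K)` for `0 → I(M, N) → Hom(M, N) → StableHom → 0`, given two inputs: `Ext^i(StableHom, K) =
0` for `i < n`, and `Ext^i(I(M, N), K) ≅ Ext^i(N, M ⊗ K)` for `i < n`.

Vanishing: the ideal `𝔞` generated by the scalars that are stably zero on `M` or on `N` kills the
stable Hom. A prime containing `𝔞` lies in both nonfree loci, so `K` has depth at least `n` there;
hence `Ext^i(S, K) = 0` for `i < n` and every finitely generated `S` killed by `𝔞`
(`subsingleton_ext_of_le_depth`).

Isomorphism: vanishing of `Ext^1` and `Ext^2` of `Tr M` gives `M ⊗ K ≅ Hom(M^*, K)`, and the higher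
ones give `Ext^i(M^*, K) = 0` for `1 ≤ i < n`. A syzygy `0 → N' → F → N → 0` yields `0 → Hom(M, N')
→ Hom(M, F) → I(M, N) → 0`. Comparing the two sequences shifts degrees, and restriction from `Hom(M,
N')` to `I(M, N')` closes the induction, because `𝔞` also kills the stable Hom into `N'`
(`nonempty_ext_projectiveHom_equiv`). -/

namespace ARDuality

/-! ### Linear functoriality and long exact sequences of `Ext`. -/

section ExtLinear

open Abelian

variable {R : Type u} [CommRing R]
variable {A B C X Y : Type u} [AddCommGroup A] [Module R A] [AddCommGroup B] [Module R B]
  [AddCommGroup C] [Module R C] [AddCommGroup X] [Module R X] [AddCommGroup Y] [Module R Y]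

/-- Contravariant functoriality of `Ext` in the first variable. -/
noncomputable def extPre (i : ℕ) (f : A →ₗ[R] B) (Y : Type u) [AddCommGroup Y] [Module R Y] :
    ExtMod R i B Y →ₗ[R] ExtMod R i A Y :=
  Ext.precompOfLinear (Ext.mk₀ (ModuleCat.ofHom f)) R (ModuleCat.of R Y) (zero_add i)

/-- Covariant functoriality of `Ext` in the second variable. -/
noncomputable def extPost (i : ℕ) (X : Type u) [AddCommGroup X] [Module R X] (f : A →ₗ[R] B) :
    ExtMod R i X A →ₗ[R] ExtMod R i X B :=
  Ext.postcompOfLinear (Ext.mk₀ (ModuleCat.ofHom f)) R (ModuleCat.of R X) (add_zero i)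

lemma extPre_comp (i : ℕ) (f : A →ₗ[R] B) (g : B →ₗ[R] C) (x : ExtMod R i C Y) :
    extPre i (g ∘ₗ f) Y x = extPre i f Y (extPre i g Y x) := by
  simp [extPre, ModuleCat.ofHom_comp, ← Ext.mk₀_comp_mk₀_assoc]

lemma extPost_comp (i : ℕ) (f : A →ₗ[R] B) (g : B →ₗ[R] C) (x : ExtMod R i X A) :
    extPost i X (g ∘ₗ f) x = extPost i X g (extPost i X f x) := by
  simp [extPost, ModuleCat.ofHom_comp, ← Ext.mk₀_comp_mk₀]

lemma extPre_id (i : ℕ) (x : ExtMod R i A Y) : extPre i LinearMap.id Y x = x := by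
  simp [extPre]

lemma extPost_id (i : ℕ) (x : ExtMod R i X A) : extPost i X LinearMap.id x = x := by
  simp [extPost]

lemma extPre_zero (i : ℕ) (x : ExtMod R i B Y) : extPre i (0 : A →ₗ[R] B) Y x = 0 := by
  simp [extPre]

lemma extPost_zero (i : ℕ) (x : ExtMod R i X A) : extPost i X (0 : A →ₗ[R] B) x = 0 := by
  simp [extPost]

lemma extPre_add (i : ℕ) (f g : A →ₗ[R] B) (x : ExtMod R i B Y) :
    extPre i (f + g) Y x = extPre i f Y x + extPre i g Y x := by
  simp [extPre, ModuleCat.ofHom_add, Ext.mk₀_add]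

lemma extPre_sum (i : ℕ) {ι : Type*} (s : Finset ι) (f : ι → A →ₗ[R] B) (x : ExtMod R i B Y) :
    extPre i (∑ k ∈ s, f k) Y x = ∑ k ∈ s, extPre i (f k) Y x := by
  classical
  induction s using Finset.induction_on with
  | empty => simp [extPre_zero]
  | insert a s ha ih => rw [Finset.sum_insert ha, Finset.sum_insert ha, extPre_add, ih]

lemma extPre_smul_id (i : ℕ) (r : R) (x : ExtMod R i A Y) :
    extPre i (r • LinearMap.id) Y x = r • x := by
  have : ModuleCat.ofHom (r • (LinearMap.id : A →ₗ[R] A)) = r • 𝟙 (ModuleCat.of R A) := rfl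
  simp [extPre, this, Ext.mk₀_smul]

lemma extPost_smul_id (i : ℕ) (r : R) (x : ExtMod R i X A) :
    extPost i X (r • LinearMap.id) x = r • x := by
  have : ModuleCat.ofHom (r • (LinearMap.id : A →ₗ[R] A)) = r • 𝟙 (ModuleCat.of R A) := rfl
  simp [extPost, this, Ext.mk₀_smul]

/-- Linearly equivalent modules in the second variable have isomorphic `Ext`. -/
noncomputable def extCongrRight (i : ℕ) (X : Type u) [AddCommGroup X] [Module R X] (e : A ≃ₗ[R] B) :
    ExtMod R i X A ≃ₗ[R] ExtMod R i X B :=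
  LinearEquiv.ofLinearMap (extPost i X e.toLinearMap) (extPost i X e.symm.toLinearMap)
    (by ext x; simp [← extPost_comp, extPost_id]) (by ext x; simp [← extPost_comp, extPost_id])

lemma subsingleton_ext_of_subsingleton_left (i : ℕ) [Subsingleton A] :
    Subsingleton (ExtMod R i A Y) :=
  subsingleton_of_forall_eq 0 fun x => by
    rw [← extPre_id i x, show (LinearMap.id : A →ₗ[R] A) = 0 from Subsingleton.elim _ _,
      extPre_zero]

lemma subsingleton_ext_of_projective (i : ℕ) [Module.Projective R A] :
    Subsingleton (ExtMod R (i + 1) A Y) :=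
  have : Projective (ModuleCat.of R A) := (IsProjective.iff_projective A).1 inferInstance
  Ext.subsingleton_of_projective _ _ _

/-- `Ext⁰` is `Hom`. -/
noncomputable def extZero (X Y : Type u) [AddCommGroup X] [Module R X] [AddCommGroup Y]
    [Module R Y] : ExtMod R 0 X Y ≃ₗ[R] (X →ₗ[R] Y) :=
  Ext.linearEquiv₀ (R := R) ≪≫ₗ ModuleCat.homLinearEquiv (S := R)

lemma extZero_symm_apply (f : X →ₗ[R] Y) :
    (extZero X Y).symm f = Ext.mk₀ (ModuleCat.ofHom f) := rfl

lemma extZero_extPre (f : A →ₗ[R] B) (x : ExtMod R 0 B Y) :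
    extZero A Y (extPre 0 f Y x) = extZero B Y x ∘ₗ f := by
  obtain ⟨g, rfl⟩ := (extZero B Y).symm.surjective x
  rw [LinearEquiv.apply_symm_apply, ← LinearEquiv.eq_symm_apply, extZero_symm_apply,
    extZero_symm_apply]
  simp [extPre, ModuleCat.ofHom_comp]

lemma shortExact_of_exact {f : A →ₗ[R] B} {g : B →ₗ[R] C} (hf : Function.Injective f)
    (hfg : Function.Exact f g) (hg : Function.Surjective g) :
    (ShortComplex.moduleCatMk f g hfg.linearMap_comp_eq_zero).ShortExact :=
  { exact := (ShortComplex.ShortExact.moduleCat_exact_iff_function_exact _).2 hfg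
    mono_f := (ModuleCat.mono_iff_injective _).2 hf
    epi_g := (ModuleCat.epi_iff_surjective _).2 hg }

section Connecting

variable {f : A →ₗ[R] B} {g : B →ₗ[R] C} (hf : Function.Injective f)
    (hfg : Function.Exact f g) (hg : Function.Surjective g)

/-- The connecting homomorphism of the contravariant long exact sequence of `Ext`. -/
noncomputable def extPreδ (i : ℕ) (Y : Type u) [AddCommGroup Y] [Module R Y] :
    ExtMod R i A Y →ₗ[R] ExtMod R (i + 1) C Y :=
  Ext.precompOfLinear (shortExact_of_exact hf hfg hg).extClass R (ModuleCat.of R Y)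
    (add_comm 1 i)

/-- The connecting homomorphism of the covariant long exact sequence of `Ext`. -/
noncomputable def extPostδ (i : ℕ) (X : Type u) [AddCommGroup X] [Module R X] :
    ExtMod R i X C →ₗ[R] ExtMod R (i + 1) X A :=
  Ext.postcompOfLinear (shortExact_of_exact hf hfg hg).extClass R (ModuleCat.of R X) rfl

include hf hfg hg in
lemma extPre_exact (i : ℕ) : Function.Exact (extPre i g Y) (extPre i f Y) :=
  (ShortComplex.ab_exact_iff_function_exact _).1
    (Ext.contravariant_sequence_exact₂' (shortExact_of_exact hf hfg hg) (ModuleCat.of R Y) i)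

lemma extPre_extPreδ_exact (i : ℕ) : Function.Exact (extPre i f Y) (extPreδ hf hfg hg i Y) :=
  (ShortComplex.ab_exact_iff_function_exact _).1
    (Ext.contravariant_sequence_exact₁' (shortExact_of_exact hf hfg hg) (ModuleCat.of R Y) i (i + 1)
      (add_comm 1 i))

lemma extPreδ_extPre_exact (i : ℕ) :
    Function.Exact (extPreδ hf hfg hg i Y) (extPre (i + 1) g Y) :=
  (ShortComplex.ab_exact_iff_function_exact _).1
    (Ext.contravariant_sequence_exact₃' (shortExact_of_exact hf hfg hg) (ModuleCat.of R Y) i (i + 1)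
      (add_comm 1 i))

include hf hfg hg in
lemma extPost_exact (i : ℕ) : Function.Exact (extPost i X f) (extPost i X g) :=
  (ShortComplex.ab_exact_iff_function_exact _).1
    (Ext.covariant_sequence_exact₂' (ModuleCat.of R X) (shortExact_of_exact hf hfg hg) i)

lemma extPostδ_extPost_exact (i : ℕ) :
    Function.Exact (extPostδ hf hfg hg i X) (extPost (i + 1) X f) :=
  (ShortComplex.ab_exact_iff_function_exact _).1
    (Ext.covariant_sequence_exact₁' (ModuleCat.of R X) (shortExact_of_exact hf hfg hg) i (i + 1)
      rfl)

-- The hypothesis is void for `i = 0`, where surjectivity of `g` suffices.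
include hf hfg hg in
lemma extPre_injective (i : ℕ) (hA : ∀ j, j + 1 = i → Subsingleton (ExtMod R j A Y)) :
    Function.Injective (extPre i g Y) := by
  cases i with
  | zero =>
    have : Epi (ModuleCat.ofHom g) := (ModuleCat.epi_iff_surjective _).2 hg
    exact Ext.precomp_mk₀_injective_of_epi (ModuleCat.of R Y) (ModuleCat.ofHom g)
  | succ j =>
    have := hA j rfl
    rw [injective_iff_map_eq_zero]
    intro x hx
    obtain ⟨y, rfl⟩ := (extPreδ_extPre_exact hf hfg hg j x).1 hx
    rw [Subsingleton.elim y 0, map_zero]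

include hf hfg hg in
lemma extPost_injective (i : ℕ) (hC : ∀ j, j + 1 = i → Subsingleton (ExtMod R j X C)) :
    Function.Injective (extPost i X f) := by
  cases i with
  | zero =>
    have : Mono (ModuleCat.ofHom f) := (ModuleCat.mono_iff_injective _).2 hf
    exact Ext.postcomp_mk₀_injective_of_mono (ModuleCat.of R X) (ModuleCat.ofHom f)
  | succ j =>
    have := hC j rfl
    rw [injective_iff_map_eq_zero]
    intro x hx
    obtain ⟨y, rfl⟩ := (extPostδ_extPost_exact hf hfg hg j x).1 hx
    rw [Subsingleton.elim y 0, map_zero]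

include hf hfg hg in
lemma subsingleton_ext_middle (i : ℕ) [Subsingleton (ExtMod R i A Y)]
    [Subsingleton (ExtMod R i C Y)] : Subsingleton (ExtMod R i B Y) :=
  subsingleton_of_forall_eq 0 fun x => by
    obtain ⟨y, rfl⟩ := (extPre_exact hf hfg hg i x).1 (Subsingleton.elim _ _)
    rw [Subsingleton.elim y 0, map_zero]

/-- If the two `Ext` groups of the middle term vanish, the connecting homomorphism is an
isomorphism. -/
noncomputable def extPreδEquiv (i : ℕ) [h₀ : Subsingleton (ExtMod R i B Y)]
    [h₁ : Subsingleton (ExtMod R (i + 1) B Y)] : ExtMod R i A Y ≃ₗ[R] ExtMod R (i + 1) C Y :=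
  LinearEquiv.ofBijective (extPreδ hf hfg hg i Y) <| by
    constructor
    · rw [injective_iff_map_eq_zero]
      intro x hx
      obtain ⟨y, rfl⟩ := (extPre_extPreδ_exact hf hfg hg i x).1 hx
      rw [Subsingleton.elim y 0, map_zero]
    · intro x
      exact (extPreδ_extPre_exact hf hfg hg i x).1 (Subsingleton.elim _ _)

/-- If `Ext¹` of the quotient vanishes, linear maps extend from the submodule. -/
lemma exists_extend_of_subsingleton_ext [Subsingleton (ExtMod R 1 C Y)] (hf : Function.Injective f)
    (hfg : Function.Exact f g) (hg : Function.Surjective g) (φ : A →ₗ[R] Y) :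
    ∃ ψ : B →ₗ[R] Y, ψ ∘ₗ f = φ := by
  obtain ⟨y, hy⟩ := (extPre_extPreδ_exact hf hfg hg 0 ((extZero A Y).symm φ)).1
    (Subsingleton.elim _ _)
  exact ⟨extZero B Y y, by rw [← extZero_extPre, hy, LinearEquiv.apply_symm_apply]⟩

end Connecting

end ExtLinear

/-! ### Vanishing of `Ext` from local depth bounds. -/

section Vanishing

variable {R : Type u} [CommRing R]

lemma exists_smul_eq_zero_of_finite {L : Type*} [AddCommGroup L] [Module R L] [Module.Finite R L]
    (T : Submonoid R) (h : ∀ x : L, ∃ s ∈ T, s • x = 0) : ∃ s ∈ T, ∀ x : L, s • x = 0 := by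
  choose s hs hsx using h
  obtain ⟨G, hG⟩ := Module.Finite.fg_top (R := R) (M := L)
  refine ⟨∏ g ∈ G, s g, T.prod_mem fun g _ => hs g, fun x => ?_⟩
  have hx : x ∈ Submodule.span R (G : Set L) := hG ▸ Submodule.mem_top
  induction hx using Submodule.span_induction with
  | mem x hx =>
    obtain ⟨c, hc⟩ := Finset.dvd_prod_of_mem s hx
    rw [hc, mul_comm, mul_smul, hsx, smul_zero]
  | zero => exact smul_zero _
  | add x y _ _ hx hy => rw [smul_add, hx, hy, add_zero]
  | smul r x _ hx => rw [smul_comm, hx, smul_zero]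

open scoped Pointwise in
/-- If `p` kills `S` and there is a weakly regular sequence of length greater than `i` on `K_p`, then
`Ext^i(S, K)` vanishes locally at `p`. -/
lemma exists_smul_ext_eq_zero [IsNoetherianRing R] (p : Ideal R) [p.IsPrime]
    {S : Type u} [AddCommGroup S] [Module R S] (hS : ∀ x ∈ p, ∀ y : S, x • y = 0)
    (rs : List (Localization.AtPrime p)) :
    ∀ (K : Type u) [AddCommGroup K] [Module R K] [Module.Finite R K] (Kp : Type u) [AddCommGroup Kp]
      [Module R Kp] [Module (Localization.AtPrime p) Kp]
      [IsScalarTower R (Localization.AtPrime p) Kp] (f : K →ₗ[R] Kp)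
      [IsLocalizedModule p.primeCompl f],
      (∀ r ∈ rs, r ∈ IsLocalRing.maximalIdeal (Localization.AtPrime p)) →
      RingTheory.Sequence.IsWeaklyRegular Kp rs →
      ∀ i < rs.length, ∀ e : ExtMod R i S K, ∃ s ∈ p.primeCompl, s • e = 0 := by
  -- The localization `Kp` is left arbitrary so that the inductive hypothesis applies to `K / aK`
  -- with localization `Kp / r Kp`, where `r = a / t`.
  induction rs with
  | nil => intro K _ _ _ Kp _ _ _ _ f _ _ _ i hi; simp at hi
  | cons r rs ih =>
    intro K _ _ _ Kp _ _ _ _ f _ hmem hreg i hi e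
    obtain ⟨a, t, rfl⟩ := IsLocalization.exists_mk'_eq p.primeCompl r
    have ha : a ∈ p := (IsLocalization.AtPrime.mk'_mem_maximal_iff
      (Localization.AtPrime p) p a t).1 (hmem _ List.mem_cons_self)
    rw [RingTheory.Sequence.isWeaklyRegular_cons_iff] at hreg
    obtain ⟨hr, hreg⟩ := hreg
    set r := IsLocalization.mk' (Localization.AtPrime p) a t with hrdef
    have htr : ∀ y : Kp, (t : R) • r • y = a • y := fun y => by
      rw [← smul_assoc, hrdef, IsLocalization.smul_mk'_self, algebraMap_smul]
    let m : K →ₗ[R] K := a • LinearMap.id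
    -- Multiplication by `a` need not be injective on `K`, but it is after localizing, so a single
    -- element outside `p` kills its kernel.
    have hker : ∀ x : LinearMap.ker m, ∃ s ∈ p.primeCompl, s • x = 0 := fun x => by
      have hx : a • (x : K) = 0 := x.2
      have hfx : f x = 0 := hr <| (IsLocalizedModule.smul_injective f t) <| by
        simp only [Submonoid.smul_def]
        rw [htr, ← map_smul, hx, map_zero, smul_zero, smul_zero]
      obtain ⟨s, hs⟩ := (IsLocalizedModule.eq_zero_iff p.primeCompl f).1 hfx
      exact ⟨s, s.2, Subtype.ext hs⟩
    obtain ⟨s₁, hs₁, hker⟩ := exists_smul_eq_zero_of_finite p.primeCompl hker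
    have hloc : (LinearMap.range m).localized' (Localization.AtPrime p) p.primeCompl f =
        r • (⊤ : Submodule (Localization.AtPrime p) Kp) := by
      ext y
      rw [Submodule.mem_localized', Submodule.mem_smul_pointwise_iff_exists]
      constructor
      · rintro ⟨_, ⟨x, rfl⟩, s, rfl⟩
        refine ⟨IsLocalizedModule.mk' f ((t : R) • x) s, trivial, ?_⟩
        rw [IsLocalizedModule.mk'_smul, smul_comm, htr, ← IsLocalizedModule.mk'_smul]
        rfl
      · rintro ⟨y, -, rfl⟩
        obtain ⟨⟨x, s⟩, rfl⟩ := IsLocalizedModule.mk'_surjective p.primeCompl f y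
        refine ⟨a • x, ⟨x, rfl⟩, t * s, ?_⟩
        rw [Function.uncurry_apply_pair, hrdef, IsLocalizedModule.mk'_smul_mk']
    -- The action of `a` on `Ext` can be computed on either variable, and `a ∈ p` kills `S`.
    have hE : extPost i S (LinearMap.range m).subtype (extPost i S m.rangeRestrict e) = 0 := by
      rw [← extPost_comp, show (LinearMap.range m).subtype ∘ₗ m.rangeRestrict = m from rfl,
        extPost_smul_id, ← extPre_smul_id,
        show a • (LinearMap.id : S →ₗ[R] S) = 0 from LinearMap.ext fun y => hS a ha y, extPre_zero]
    have hsub := (LinearMap.range m).injective_subtype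
    have hex : Function.Exact (LinearMap.range m).subtype (LinearMap.range m).mkQ :=
      LinearMap.exact_subtype_mkQ _
    have hmk := (LinearMap.range m).mkQ_surjective
    -- The image of `e` in `Ext^i(S, aK)` dies in `Ext^i(S, K)`, so it comes from `Ext^{i-1}(S, K /
    -- aK)`, where induction applies.
    obtain ⟨s₂, hs₂, hE⟩ : ∃ s ∈ p.primeCompl, s • extPost i S m.rangeRestrict e = 0 := by
      cases i with
      | zero =>
        have := extPost_injective (X := S) hsub hex hmk 0 (by simp)
        exact ⟨1, one_mem _, by rw [one_smul]; exact this (hE.trans (map_zero _).symm)⟩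
      | succ j =>
        obtain ⟨y, hy⟩ := (extPostδ_extPost_exact hsub hex hmk j _).1 hE
        obtain ⟨s, hs, hsy⟩ := ih (K ⧸ LinearMap.range m) _ ((LinearMap.range m).toLocalizedQuotient'
            (Localization.AtPrime p) p.primeCompl f)
          (fun r hr => hmem r (List.mem_cons_of_mem _ hr))
          (((Submodule.quotEquivOfEq _ _ hloc).isWeaklyRegular_congr rs).2 hreg) j
          (by simpa using hi) y
        exact ⟨s, hs, by rw [← hy, ← map_smul, hsy, map_zero]⟩
    have hex' : Function.Exact (LinearMap.ker m).subtype m.rangeRestrict := by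
      rw [LinearMap.exact_iff, LinearMap.ker_rangeRestrict, Submodule.range_subtype]
    -- Now `s₂ • e` comes from `Ext^i(S, ker m)`, which `s₁` kills.
    obtain ⟨x, hx⟩ := (extPost_exact (X := S) (LinearMap.ker m).injective_subtype hex'
      m.surjective_rangeRestrict i (s₂ • e)).1 (by rw [map_smul, hE])
    refine ⟨s₁ * s₂, mul_mem hs₁ hs₂, ?_⟩
    rw [mul_smul, ← hx, ← map_smul, ← extPost_smul_id,
      show s₁ • (LinearMap.id : LinearMap.ker m →ₗ[R] _) = 0 from LinearMap.ext fun y => hker y,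
      extPost_zero, map_zero]

/-- Noetherian induction on an ideal `I` killing `S`: the kernel and cokernel of multiplication by
`x ∉ I` on `S` are killed by the larger ideal `I + (x)`. This replaces a prime filtration of `S`. -/
lemma subsingleton_ext_of_le_depth [IsNoetherianRing R] (𝔞 : Ideal R)
    (K : Type u) [AddCommGroup K] [Module R K] [Module.Finite R K] (n : ℕ)
    (hK : ∀ p : PrimeSpectrum R, 𝔞 ≤ p.asIdeal → p ∈ depthGELocus R K n) (I : Ideal R) :
    𝔞 ≤ I → ∀ (S : Type u) [AddCommGroup S] [Module R S] [Module.Finite R S],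
      (∀ x ∈ I, ∀ y : S, x • y = 0) → ∀ i < n, Subsingleton (ExtMod R i S K) := by
  induction I using IsNoetherian.induction with
  | hgt J ih =>
    obtain ⟨I, rfl⟩ : ∃ I : Ideal R, I = J := ⟨J, rfl⟩
    intro hI S _ _ _ hS i hi
    have key : ∀ (x : R), x ∉ I → ∀ (S' : Type u) [AddCommGroup S'] [Module R S']
        [Module.Finite R S'], (∀ y ∈ I, ∀ z : S', y • z = 0) → (∀ z : S', x • z = 0) →
        ∀ i < n, Subsingleton (ExtMod R i S' K) := by
      intro x hx S' _ _ _ hS' hxS' i hi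
      refine ih (I ⊔ Ideal.span {x}) ?_ (hI.trans le_sup_left) S' ?_ i hi
      · refine lt_of_le_of_ne le_sup_left fun h => hx ?_
        rw [h]
        exact Ideal.mem_sup_right (Ideal.mem_span_singleton_self x)
      · intro y hy z
        obtain ⟨u, hu, v, hv, rfl⟩ := Submodule.mem_sup.1 hy
        obtain ⟨c, rfl⟩ := Ideal.mem_span_singleton'.1 hv
        rw [add_smul, hS' u hu, mul_smul, hxS', smul_zero, add_zero]
    by_cases htop : I = ⊤
    · have : Subsingleton S := subsingleton_of_forall_eq 0 fun y => by
        rw [← one_smul R y]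
        exact hS 1 (htop ▸ Submodule.mem_top) y
      exact subsingleton_ext_of_subsingleton_left i
    have hrange : ∀ (x : R), x ∉ I → ∀ i < n,
        Subsingleton (ExtMod R i (S ⧸ LinearMap.range (x • (LinearMap.id : S →ₗ[R] S))) K) := by
      intro x hx i hi
      refine key x hx _ (fun y hy z => ?_) (fun z => ?_) i hi
      all_goals obtain ⟨z, rfl⟩ := Submodule.Quotient.mk_surjective _ z
      · rw [← Submodule.Quotient.mk_smul, hS y hy, Submodule.Quotient.mk_zero]
      · rw [← Submodule.Quotient.mk_smul, Submodule.Quotient.mk_eq_zero]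
        exact ⟨z, rfl⟩
    by_cases hp : I.IsPrime
    -- Factor `x` as `S → xS → S`. Vanishing for the kernel in degree `i - 1` and for the cokernel
    -- in degree `i` makes both induced maps on `Ext` injective.
    · have hreg : ∀ x ∉ I, ∀ e : ExtMod R i S K, x • e = 0 → e = 0 := by
        intro x hx e he
        let m : S →ₗ[R] S := x • LinearMap.id
        rw [← extPre_smul_id, show x • (LinearMap.id : S →ₗ[R] S) =
          (LinearMap.range m).subtype ∘ₗ m.rangeRestrict from rfl, extPre_comp] at he
        have hex' : Function.Exact (LinearMap.ker m).subtype m.rangeRestrict := by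
          rw [LinearMap.exact_iff, LinearMap.ker_rangeRestrict, Submodule.range_subtype]
        have h1 := extPre_injective (Y := K) (LinearMap.ker m).injective_subtype hex'
          m.surjective_rangeRestrict i (fun j hj => key x hx _
            (fun y hy z => Subtype.ext (hS y hy _)) (fun z => Subtype.ext z.2) j (by lia))
          (he.trans (map_zero _).symm)
        have := hrange x hx i hi
        obtain ⟨y, rfl⟩ := (extPre_exact (LinearMap.range m).injective_subtype
          (LinearMap.exact_subtype_mkQ _) (LinearMap.range m).mkQ_surjective i e).1 h1
        rw [Subsingleton.elim y 0, map_zero]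
      have hd : (i : ℕ∞) < depth (Localization.AtPrime I) (LocalizedModule I.primeCompl K) :=
        lt_of_lt_of_le (Nat.cast_lt.2 hi) (hK ⟨I, hp⟩ hI)
      simp only [depth, lt_iSup_iff] at hd
      obtain ⟨rs, ⟨hmem, hrs⟩, hlen⟩ := hd
      -- Each class is killed by some `s ∉ I` by the local vanishing, while `s` acts injectively.
      refine subsingleton_of_forall_eq 0 fun e => ?_
      obtain ⟨s, hs, hse⟩ := exists_smul_ext_eq_zero I hS rs K _
        (LocalizedModule.mkLinearMap I.primeCompl K) hmem hrs i (Nat.cast_lt.1 hlen) e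
      exact hreg s hs e hse
    -- With `x * y ∈ I`, the submodule `xS` is killed by `I + (y)` and the quotient `S / xS` by `I +
    -- (x)`.
    · obtain ⟨x, hx, y, hy, hxy⟩ := (Ideal.not_isPrime_iff.1 hp).resolve_left htop
      have := hrange x hx i hi
      have : Subsingleton (ExtMod R i (LinearMap.range (x • (LinearMap.id : S →ₗ[R] S))) K) := by
        refine key y hy _ (fun z hz w => Subtype.ext (hS z hz _)) ?_ i hi
        rintro ⟨_, w, rfl⟩
        refine Subtype.ext ?_
        change y • x • w = 0
        rw [← mul_smul, mul_comm, hS _ hxy]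
      let m : S →ₗ[R] S := x • LinearMap.id
      exact subsingleton_ext_middle (LinearMap.range m).injective_subtype
        (LinearMap.exact_subtype_mkQ _) (LinearMap.range m).mkQ_surjective i

end Vanishing

/-! ### Scalars that are stably zero on a module. -/

section StableIdeal

variable {R : Type u} [CommRing R]
variable {L M N : Type u} [AddCommGroup L] [Module R L] [AddCommGroup M] [Module R M]
  [AddCommGroup N] [Module R N]

lemma comp_mem_projectiveHom_of_left (f : L →ₗ[R] M) {g : M →ₗ[R] N}
    (hg : g ∈ projectiveHom R M N) : g ∘ₗ f ∈ projectiveHom R L N := by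
  obtain ⟨P, _, _, h₁, h₂, a, b, rfl⟩ := hg
  exact ⟨P, _, _, h₁, h₂, a ∘ₗ f, b, rfl⟩

lemma comp_mem_projectiveHom_of_right {f : L →ₗ[R] M} (g : M →ₗ[R] N)
    (hf : f ∈ projectiveHom R L M) : g ∘ₗ f ∈ projectiveHom R L N := by
  obtain ⟨P, _, _, h₁, h₂, a, b, rfl⟩ := hf
  exact ⟨P, _, _, h₁, h₂, a, g ∘ₗ b, rfl⟩

variable (R M) in
/-- The ideal of the elements of `R` that act on `M` by an endomorphism factoring through a
finitely generated projective module. -/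
def stableIdeal : Ideal R :=
  (projectiveHom R M M).comap (LinearMap.toSpanSingleton R (M →ₗ[R] M) LinearMap.id)

lemma mem_stableIdeal {r : R} :
    r ∈ stableIdeal R M ↔ r • (LinearMap.id : M →ₗ[R] M) ∈ projectiveHom R M M := Iff.rfl

lemma smul_stableHom_eq_zero {r : R} (hr : r ∈ stableIdeal R M ⊔ stableIdeal R N)
    (x : StableHom R M N) : r • x = 0 := by
  obtain ⟨f, rfl⟩ := Submodule.Quotient.mk_surjective _ x
  rw [← Submodule.Quotient.mk_smul, Submodule.Quotient.mk_eq_zero]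
  obtain ⟨a, ha, b, hb, rfl⟩ := Submodule.mem_sup.1 hr
  rw [add_smul]
  refine Submodule.add_mem _ ?_ ?_
  · convert comp_mem_projectiveHom_of_right f (mem_stableIdeal.1 ha) using 1
    ext; simp
  · convert comp_mem_projectiveHom_of_left f (mem_stableIdeal.1 hb) using 1
    ext; simp

/-- If `r • id` on `N` is `h ∘ g`, lift `h` to `h'` along `π`. Then `r • id - h' ∘ g ∘ π` maps `F`
into `ker π` and restricts to `r • id` there. Thus one ideal serves all syzygies of `N`. -/
lemma stableIdeal_le_of_projective {F : Type u} [AddCommGroup F] [Module R F] [Module.Finite R F]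
    [Module.Projective R F] (π : F →ₗ[R] N) (hπ : Function.Surjective π) :
    stableIdeal R N ≤ stableIdeal R (LinearMap.ker π) := by
  intro r hr
  obtain ⟨P, _, _, _, _, g, h, hgh⟩ := mem_stableIdeal.1 hr
  obtain ⟨h', rfl⟩ := Module.projective_lifting_property π h hπ
  have hsub : ∀ x : F, π (r • x - h' (g (π x))) = 0 := fun x => by
    have := LinearMap.congr_fun hgh (π x)
    simp only [LinearMap.smul_apply, LinearMap.id_apply, LinearMap.comp_apply] at this
    rw [map_sub, map_smul, this, sub_self]
  let k : F →ₗ[R] LinearMap.ker π :=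
    LinearMap.codRestrict _ (r • LinearMap.id - h' ∘ₗ g ∘ₗ π) hsub
  refine ⟨F, _, _, inferInstance, inferInstance, (LinearMap.ker π).subtype, k, ?_⟩
  ext x
  have hx : π x = 0 := x.2
  change r • (x : F) = r • (x : F) - h' (g (π x))
  rw [hx, map_zero, map_zero, sub_zero]

/-- If `M_p` were free, a surjection `R^a → M` would split at `p`. Clearing denominators in the
splitting makes a scalar outside `p` factor through `R^a`. -/
lemma mem_nonfreeLocus_of_stableIdeal_le [IsNoetherianRing R] [Module.Finite R M]
    {p : PrimeSpectrum R} (hp : stableIdeal R M ≤ p.asIdeal) : p ∈ nonfreeLocus R M := by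
  intro hfree
  have hfree : Module.Free (Localization.AtPrime p.asIdeal)
    (LocalizedModule p.asIdeal.primeCompl M) := hfree
  let S := p.asIdeal.primeCompl
  obtain ⟨a, π, hπ⟩ := Module.Finite.exists_fin' R M
  obtain ⟨σ, hσ⟩ := Module.projective_lifting_property (LocalizedModule.map S π) LinearMap.id
    (LocalizedModule.map_surjective S π hπ)
  have := Module.finitePresentation_of_finite R M
  obtain ⟨h, s, hs⟩ := Module.FinitePresentation.exists_lift_of_isLocalizedModule S
    (LocalizedModule.mkLinearMap S (Fin a → R))
    (σ.restrictScalars R ∘ₗ LocalizedModule.mkLinearMap S M)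
  let d : M →ₗ[R] M := π ∘ₗ h - (s : R) • LinearMap.id
  have hd : ∀ x : LinearMap.range d, ∃ t ∈ S, t • x = 0 := by
    rintro ⟨_, m, rfl⟩
    have hdm : LocalizedModule.mkLinearMap S M (d m) = 0 := by
      have h1 : LocalizedModule.mkLinearMap S (Fin a → R) (h m) =
        (s : R) • σ (LocalizedModule.mkLinearMap S M m) := LinearMap.congr_fun hs m
      have h2 : LocalizedModule.map S π (LocalizedModule.mkLinearMap S (Fin a → R) (h m)) =
          LocalizedModule.mkLinearMap S M (π (h m)) :=
        IsLocalizedModule.map_apply S (LocalizedModule.mkLinearMap S (Fin a → R))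
          (LocalizedModule.mkLinearMap S M) π (h m)
      have h3 : LocalizedModule.map S π (σ (LocalizedModule.mkLinearMap S M m)) =
        LocalizedModule.mkLinearMap S M m := LinearMap.congr_fun hσ _
      rw [h1, LinearMap.map_smul_of_tower, h3] at h2
      change LocalizedModule.mkLinearMap S M (π (h m) - (s : R) • m) = 0
      rw [map_sub, map_smul, h2, sub_self]
    obtain ⟨t, ht⟩ := (IsLocalizedModule.eq_zero_iff S (LocalizedModule.mkLinearMap S M)).1 hdm
    exact ⟨t, t.2, Subtype.ext ht⟩
  obtain ⟨t, ht, htd⟩ := exists_smul_eq_zero_of_finite S hd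
  refine mul_mem ht s.2 (hp ?_)
  have e : (t * (s : R)) • (LinearMap.id : M →ₗ[R] M) = (t • π) ∘ₗ h := by
    ext m
    have : t • d m = 0 := congrArg Subtype.val (htd ⟨d m, m, rfl⟩)
    simp only [d, LinearMap.sub_apply, LinearMap.smul_apply, smul_sub, sub_eq_zero,
      LinearMap.comp_apply, LinearMap.id_apply] at this
    simp [mul_smul, this]
  rw [mem_stableIdeal, e]
  exact ⟨Fin a → R, _, _, inferInstance, inferInstance, h, t • π, rfl⟩

end StableIdeal

/-! ### Consequences of torsionfreeness for `M^*` and `M ⊗ K`. -/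

section Torsionfree

variable {R : Type u} [CommRing R]
variable {M K : Type u} [AddCommGroup M] [Module R M] [AddCommGroup K] [Module R K]

namespace FinProjPresentation

variable (P : FinProjPresentation R M)

/-- The dual of the differential, with values in its range. -/
def dualCorestrict : Module.Dual R P.P₀ →ₗ[R] LinearMap.range P.d.dualMap :=
  P.d.dualMap.rangeRestrict

lemma dualCorestrict_surjective : Function.Surjective P.dualCorestrict :=
  P.d.dualMap.surjective_rangeRestrict

lemma dualCorestrict_exact : Function.Exact P.π.dualMap P.dualCorestrict := by
  rw [dualCorestrict, LinearMap.exact_iff, LinearMap.ker_rangeRestrict, ← LinearMap.exact_iff]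
  exact LinearMap.exact_lcomp_of_exact_of_surjective R P.exact P.surjective

lemma dual_injective : Function.Injective P.π.dualMap :=
  LinearMap.dualMap_injective_of_surjective P.surjective

lemma subsingleton_ext_range (i : ℕ) [Subsingleton (ExtMod R (i + 2) P.transpose K)] :
    Subsingleton (ExtMod R (i + 1) (LinearMap.range P.d.dualMap) K) :=
  have := subsingleton_ext_of_projective (R := R) (A := Module.Dual R P.P₁) (Y := K) i
  have := subsingleton_ext_of_projective (R := R) (A := Module.Dual R P.P₁) (Y := K) (i + 1)
  (extPreδEquiv (LinearMap.range P.d.dualMap).injective_subtype (LinearMap.exact_subtype_mkQ _)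
    (LinearMap.range P.d.dualMap).mkQ_surjective (Y := K) (i + 1)).toEquiv.subsingleton

/-- `M^*` is a second syzygy of `Tr M`, up to projectives: dimension shifting along `0 → M^* → P₀^*
→ P₁^* → Tr M → 0`. -/
lemma subsingleton_ext_dual (i : ℕ) [Subsingleton (ExtMod R (i + 3) P.transpose K)] :
    Subsingleton (ExtMod R (i + 1) (Module.Dual R M) K) :=
  have := subsingleton_ext_of_projective (R := R) (A := Module.Dual R P.P₀) (Y := K) i
  have := subsingleton_ext_of_projective (R := R) (A := Module.Dual R P.P₀) (Y := K) (i + 1)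
  have := P.subsingleton_ext_range (K := K) (i + 1)
  (extPreδEquiv (A := Module.Dual R M) (B := Module.Dual R P.P₀)
    (C := LinearMap.range P.d.dualMap) P.dual_injective P.dualCorestrict_exact
    P.dualCorestrict_surjective (Y := K) (i + 1)).toEquiv.subsingleton

end FinProjPresentation

variable (R M K) in
/-- The canonical map `M ⊗ K → Hom(M^*, K)`. -/
noncomputable def tensorToHomDual : M ⊗[R] K →ₗ[R] (Module.Dual R M →ₗ[R] K) :=
  dualTensorHom R (Module.Dual R M) K ∘ₗ (Module.Dual.eval R M).rTensor K

@[simp]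
lemma tensorToHomDual_tmul (m : M) (k : K) (l : Module.Dual R M) :
    tensorToHomDual R M K (m ⊗ₜ k) l = l m • k := by
  simp [tensorToHomDual]

lemma tensorToHomDual_rTensor {M' : Type u} [AddCommGroup M'] [Module R M'] (f : M →ₗ[R] M')
    (x : M ⊗[R] K) :
    tensorToHomDual R M' K (f.rTensor K x) = tensorToHomDual R M K x ∘ₗ f.dualMap := by
  induction x with
  | zero => simp
  | tmul m k => ext; simp
  | add x y hx hy => simp [hx, hy, LinearMap.add_comp]

lemma tensorToHomDual_bijective_of_projective [Module.Finite R M] [Module.Projective R M] :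
    Function.Bijective (tensorToHomDual R M K) := by
  refine dualTensorHom_bijective.comp ?_
  exact (LinearEquiv.rTensor K (Module.evalEquiv R M)).bijective

/-- The map is bijective for `P₀` and `P₁`. With `B` the range of `P₀^* → P₁^*`, `Ext^1(Tr M, K) =
0` extends maps `B → K` to `P₁^*`, giving injectivity; `Ext^2(Tr M, K) ≅ Ext^1(B, K)` is the
obstruction to extending maps `M^* → K` to `P₀^*`, giving surjectivity. -/
lemma tensorToHomDual_bijective (P : FinProjPresentation R M)
    [Subsingleton (ExtMod R 1 P.transpose K)] [Subsingleton (ExtMod R 2 P.transpose K)] :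
    Function.Bijective (tensorToHomDual R M K) := by
  have h0 := tensorToHomDual_bijective_of_projective (R := R) (M := P.P₀) (K := K)
  have h1 := tensorToHomDual_bijective_of_projective (R := R) (M := P.P₁) (K := K)
  have hB := P.subsingleton_ext_range (K := K) 0
  have hπ := LinearMap.rTensor_surjective K P.surjective
  have hex := rTensor_exact K P.exact P.surjective
  constructor
  · rw [injective_iff_map_eq_zero]
    intro x hx
    obtain ⟨y, rfl⟩ := hπ x
    rw [tensorToHomDual_rTensor] at hx
    obtain ⟨φ, hφ⟩ := (LinearMap.exact_lcomp_of_exact_of_surjective (M1 := Module.Dual R M)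
      (M2 := Module.Dual R P.P₀) (M3 := LinearMap.range P.d.dualMap) K P.dualCorestrict_exact
      P.dualCorestrict_surjective (tensorToHomDual R P.P₀ K y)).1 hx
    obtain ⟨ψ, rfl⟩ := exists_extend_of_subsingleton_ext
      (LinearMap.range P.d.dualMap).injective_subtype (LinearMap.exact_subtype_mkQ _)
      (LinearMap.range P.d.dualMap).mkQ_surjective φ
    obtain ⟨z, rfl⟩ := h1.2 ψ
    refine (hex y).2 ⟨z, h0.1 ?_⟩
    rw [tensorToHomDual_rTensor, ← hφ]
    rfl
  · intro φ
    obtain ⟨ψ, rfl⟩ := exists_extend_of_subsingleton_ext (A := Module.Dual R M)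
      (B := Module.Dual R P.P₀) (C := LinearMap.range P.d.dualMap) P.dual_injective P.dualCorestrict_exact
      P.dualCorestrict_surjective φ
    obtain ⟨y, rfl⟩ := h0.2 ψ
    exact ⟨_, tensorToHomDual_rTensor _ _⟩

end Torsionfree

/-! ### Linear functionals on the homomorphisms factoring through projectives. -/

section HomProjective

variable {R : Type u} [CommRing R]
variable {M N K : Type u} [AddCommGroup M] [Module R M] [AddCommGroup N] [Module R N]
  [AddCommGroup K] [Module R K]

lemma smulRight_mem_projectiveHom (l : Module.Dual R M) (x : N) :
    l.smulRight x ∈ projectiveHom R M N :=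
  ⟨R, _, _, inferInstance, inferInstance, l, LinearMap.toSpanSingleton R N x, by ext; simp⟩

lemma comp_eq_sum_smulRight {b : ℕ} (π : (Fin b → R) →ₗ[R] N) (g : M →ₗ[R] Fin b → R) :
    π ∘ₗ g = ∑ i, (LinearMap.proj i ∘ₗ g).smulRight (π (Pi.single i 1)) := by
  ext m
  simp only [LinearMap.comp_apply, LinearMap.sum_apply, LinearMap.smulRight_apply,
    LinearMap.proj_apply, ← map_smul, ← map_sum]
  congr 1
  ext j
  simp [Pi.single_apply]

/-- For a surjection `π : F → N`, composition with `π` as a map from `Hom(M, F)` to the submodule of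
the homomorphisms `M → N` that factor through projectives. -/
def compProjective (M : Type u) [AddCommGroup M] [Module R M] {F : Type u} [AddCommGroup F]
    [Module R F] [Module.Finite R F] [Module.Projective R F] (π : F →ₗ[R] N) :
    (M →ₗ[R] F) →ₗ[R] projectiveHom R M N :=
  (π.compRight R).codRestrict _ fun g => ⟨F, _, _, inferInstance, inferInstance, g, π, rfl⟩

section

variable {F : Type u} [AddCommGroup F] [Module R F] [Module.Finite R F] [Module.Projective R F]
  (π : F →ₗ[R] N)

lemma compProjective_surjective (hπ : Function.Surjective π) :
    Function.Surjective (compProjective M π) := by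
  rintro ⟨_, P, _, _, _, _, g, h, rfl⟩
  obtain ⟨h', rfl⟩ := Module.projective_lifting_property π h hπ
  exact ⟨h' ∘ₗ g, rfl⟩

variable {N' : Type u} [AddCommGroup N'] [Module R N'] {ι : N' →ₗ[R] F} {π}

omit [Module.Finite R F] [Module.Projective R F] in
lemma compRight_injective (hι : Function.Injective ι) :
    Function.Injective (ι.compRight R (M := M)) := fun _ _ h =>
  LinearMap.ext fun m => hι (LinearMap.congr_fun h m)

lemma compProjective_exact (hι : Function.Injective ι) (hιπ : Function.Exact ι π) :
    Function.Exact (ι.compRight R (M := M)) (compProjective M π) := by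
  intro g
  constructor
  · intro hg
    have h : ∀ m, g m ∈ LinearMap.range ι := fun m =>
      (hιπ _).1 (LinearMap.congr_fun (congrArg Subtype.val hg) m)
    refine ⟨(LinearEquiv.ofInjective ι hι).symm.toLinearMap ∘ₗ g.codRestrict _ h, ?_⟩
    ext m
    exact congrArg Subtype.val ((LinearEquiv.ofInjective ι hι).apply_symm_apply ⟨g m, h m⟩)
  · rintro ⟨f, rfl⟩
    exact Subtype.ext (LinearMap.ext fun m => hιπ.apply_apply_eq_zero _)

end

variable (N) in
/-- Every finitely generated module over a noetherian ring has a first syzygy. -/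
lemma exists_syzygy [IsNoetherianRing R] [Module.Finite R N] :
    ∃ (N' : Type u) (_ : AddCommGroup N') (_ : Module R N') (b : ℕ) (ι : N' →ₗ[R] Fin b → R)
      (π : (Fin b → R) →ₗ[R] N), Module.Finite R N' ∧ Function.Injective ι ∧ Function.Exact ι π ∧
        Function.Surjective π ∧ stableIdeal R N ≤ stableIdeal R N' := by
  obtain ⟨b, π, hπ⟩ := Module.Finite.exists_fin' R N
  exact ⟨LinearMap.ker π, inferInstance, inferInstance, b, (LinearMap.ker π).subtype, π,
    inferInstance, Submodule.injective_subtype _, π.exact_subtype_ker_map, hπ,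
    stableIdeal_le_of_projective π hπ⟩

/-- Such homomorphisms factor through a fixed surjection `R^b → N`, hence are sums of rank one maps
`l.smulRight x`. -/
lemma projectiveHom_ext [Module.Finite R N] {φ φ' : projectiveHom R M N →ₗ[R] K}
    (h : ∀ (x : N) (l : Module.Dual R M),
      φ ⟨l.smulRight x, smulRight_mem_projectiveHom l x⟩ =
        φ' ⟨l.smulRight x, smulRight_mem_projectiveHom l x⟩) : φ = φ' := by
  obtain ⟨b, π, hπ⟩ := Module.Finite.exists_fin' R N
  ext f
  obtain ⟨g, rfl⟩ := compProjective_surjective (M := M) π hπ f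
  have : compProjective M π g = ∑ i, ⟨(LinearMap.proj i ∘ₗ g).smulRight (π (Pi.single i 1)),
      smulRight_mem_projectiveHom _ _⟩ := by
    ext1
    rw [AddSubmonoidClass.coe_finsetSum]
    exact comp_eq_sum_smulRight π g
  rw [this, map_sum, map_sum]
  exact Finset.sum_congr rfl fun i _ => h _ _

variable (M N K) in
/-- A linear map from the submodule of `Hom(M, N)` of the homomorphisms factoring through projectives
induces a linear map `N → Hom(M^*, K)`. -/
def homProjectiveToHom :
    (projectiveHom R M N →ₗ[R] K) →ₗ[R] (N →ₗ[R] Module.Dual R M →ₗ[R] K) where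
  toFun φ := LinearMap.mk₂ R
    (fun x l => φ ⟨l.smulRight x, smulRight_mem_projectiveHom l x⟩)
    (fun x y l => by rw [← map_add]; congr 1; ext; simp)
    (fun c x l => by rw [← map_smul]; congr 1; ext m; exact smul_comm (l m) c x)
    (fun x l l' => by rw [← map_add]; congr 1; ext; simp [add_smul])
    (fun c x l => by rw [← map_smul]; congr 1; ext; simp [mul_smul])
  map_add' φ φ' := by ext; simp
  map_smul' c φ := by ext; simp

lemma homProjectiveToHom_apply (φ : projectiveHom R M N →ₗ[R] K) (x : N) (l : Module.Dual R M) :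
    homProjectiveToHom M N K φ x l = φ ⟨l.smulRight x, smulRight_mem_projectiveHom l x⟩ := rfl

lemma homProjectiveToHom_injective [Module.Finite R N] :
    Function.Injective (homProjectiveToHom (R := R) M N K) := fun _ _ h =>
  projectiveHom_ext fun x l => LinearMap.congr_fun (LinearMap.congr_fun h x) l

/-- The linear map `Hom(M, R^b) → K` induced by a linear map `R^b → Hom(M^*, K)`. -/
def ofHomFree {b : ℕ} (ψ : (Fin b → R) →ₗ[R] Module.Dual R M →ₗ[R] K) :
    (M →ₗ[R] Fin b → R) →ₗ[R] K :=
  ∑ i, ψ (Pi.single i 1) ∘ₗ (LinearMap.proj i : (Fin b → R) →ₗ[R] R).compRight R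

lemma ofHomFree_smulRight {b : ℕ} (ψ : (Fin b → R) →ₗ[R] Module.Dual R M →ₗ[R] K)
    (x : Fin b → R) (l : Module.Dual R M) : ofHomFree ψ (l.smulRight x) = ψ x l := by
  have h : ∀ i, (LinearMap.proj i : (Fin b → R) →ₗ[R] R) ∘ₗ l.smulRight x = x i • l := fun i => by
    ext m; simp [mul_comm]
  simp only [ofHomFree, LinearMap.sum_apply, LinearMap.comp_apply, LinearMap.compRight_apply, h,
    map_smul]
  conv_rhs => rw [← (Pi.basisFun R (Fin b)).sum_repr x]
  simp

/-- This is the degree zero case of the `Ext` isomorphism. For surjectivity, `ψ ∘ π` defines a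
functional `Ψ` on `Hom(M, R^b)`, which must descend along the quotient by `Hom(M, N')`. -/
lemma homProjectiveToHom_bijective {b : ℕ} {π : (Fin b → R) →ₗ[R] N}
    {N' : Type u} [AddCommGroup N'] [Module R N'] [Module.Finite R N'] {ι : N' →ₗ[R] Fin b → R}
    (hι : Function.Injective ι) (hιπ : Function.Exact ι π) (hπ : Function.Surjective π)
    (h : Subsingleton (ExtMod R 0 (StableHom R M N') K)) :
    Function.Bijective (homProjectiveToHom (R := R) M N K) := by
  have := Module.Finite.of_surjective π hπ
  refine ⟨homProjectiveToHom_injective, fun ψ => ?_⟩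
  let Ψ := ofHomFree (ψ ∘ₗ π)
  -- `Ψ` vanishes on rank one maps into `N'`, so on `Hom(M, N')` it factors through the stable Hom,
  -- which has no nonzero map to `K`.
  have hΨ : Ψ ∘ₗ ι.compRight R = 0 := by
    have hle : projectiveHom R M N' ≤ LinearMap.ker (Ψ ∘ₗ ι.compRight R) := by
      intro f hf
      have : (Ψ ∘ₗ ι.compRight R) ∘ₗ (projectiveHom R M N').subtype = 0 := by
        refine projectiveHom_ext fun x l => ?_
        have hx : π (ι x) = 0 := hιπ.apply_apply_eq_zero x
        have e : ι ∘ₗ l.smulRight x = l.smulRight (ι x) := by ext; simp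
        refine (congrArg Ψ e).trans ((ofHomFree_smulRight (ψ ∘ₗ π) (ι x) l).trans ?_)
        rw [LinearMap.comp_apply, hx, map_zero]
        rfl
      exact LinearMap.congr_fun this ⟨f, hf⟩
    rw [← Submodule.liftQ_mkQ (projectiveHom R M N') (Ψ ∘ₗ ι.compRight R) hle,
      show Submodule.liftQ _ (Ψ ∘ₗ ι.compRight R) hle = 0 from
        (extZero (StableHom R M N') K).symm.injective (Subsingleton.elim _ _),
      LinearMap.zero_comp]
  obtain ⟨φ, hφ⟩ := (LinearMap.exact_lcomp_of_exact_of_surjective (M1 := M →ₗ[R] N')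
    (M2 := M →ₗ[R] Fin b → R) (M3 := projectiveHom R M N) K (compProjective_exact hι hιπ)
    (compProjective_surjective (M := M) π hπ) Ψ).1 hΨ
  refine ⟨φ, ?_⟩
  ext x l
  obtain ⟨y, rfl⟩ := hπ x
  rw [homProjectiveToHom_apply]
  have h1 : φ (compProjective M π (l.smulRight y)) = Ψ (l.smulRight y) := LinearMap.congr_fun hφ _
  rw [ofHomFree_smulRight] at h1
  rw [← LinearMap.comp_apply ψ, ← h1]
  congr 1
  ext m
  exact (map_smul π _ _).symm

/-- The composite of restriction to `projectiveHom` with `homProjectiveToHom`. -/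
def homHomToHom (M N K : Type u) [AddCommGroup M] [Module R M] [AddCommGroup N] [Module R N]
    [AddCommGroup K] [Module R K] :
    ((M →ₗ[R] N) →ₗ[R] K) →ₗ[R] (N →ₗ[R] Module.Dual R M →ₗ[R] K) :=
  homProjectiveToHom M N K ∘ₗ (projectiveHom R M N).subtype.lcomp R K

lemma homHomToHom_apply (φ : (M →ₗ[R] N) →ₗ[R] K) (x : N) (l : Module.Dual R M) :
    homHomToHom M N K φ x l = φ (l.smulRight x) := rfl

lemma homHomToHom_comp {N' : Type u} [AddCommGroup N'] [Module R N'] (f : N' →ₗ[R] N)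
    (φ : (M →ₗ[R] N) →ₗ[R] K) :
    homHomToHom M N' K (φ ∘ₗ f.compRight R) = homHomToHom M N K φ ∘ₗ f := by
  ext x l
  simp only [homHomToHom_apply, LinearMap.comp_apply, LinearMap.compRight_apply]
  congr 1
  ext m
  simp

lemma homHomToHom_surjective {b : ℕ} :
    Function.Surjective (homHomToHom (R := R) M (Fin b → R) K) := fun ψ =>
  ⟨ofHomFree ψ, LinearMap.ext fun x => LinearMap.ext fun l => ofHomFree_smulRight ψ x l⟩

end HomProjective

/-! ### Dimension shifting along syzygies of `N`. -/

section Main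

variable {R : Type u} [CommRing R]

/-- The identity of `Hom(M, R^b)` is a sum of maps factoring through `M^*`. -/
lemma subsingleton_ext_hom_free {M K : Type u} [AddCommGroup M] [Module R M] [AddCommGroup K]
    [Module R K] (i b : ℕ) [Subsingleton (ExtMod R i (Module.Dual R M) K)] :
    Subsingleton (ExtMod R i (M →ₗ[R] Fin b → R) K) :=
  subsingleton_of_forall_eq 0 fun e => by
    have h : (LinearMap.id : (M →ₗ[R] Fin b → R) →ₗ[R] _) =
        ∑ k, (LinearMap.single R (fun _ : Fin b => R) k).compRight R ∘ₗ
          (LinearMap.proj k : (Fin b → R) →ₗ[R] R).compRight R := by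
      ext g m j
      simp [LinearMap.sum_apply, Pi.single_apply]
    rw [← extPre_id i e, h, extPre_sum]
    refine Finset.sum_eq_zero fun k _ => ?_
    rw [extPre_comp, Subsingleton.elim (extPre i _ K e : ExtMod R i (Module.Dual R M) K) 0, map_zero]

/-- Surjections with corresponding kernels have isomorphic targets. -/
noncomputable def equivOfSurjective {A A' B B' : Type*} [AddCommGroup A] [Module R A]
    [AddCommGroup A'] [Module R A'] [AddCommGroup B] [Module R B] [AddCommGroup B'] [Module R B']
    (e : A ≃ₗ[R] A') (δ : A →ₗ[R] B) (δ' : A' →ₗ[R] B') (hδ : Function.Surjective δ)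
    (hδ' : Function.Surjective δ') (h : ∀ x, δ x = 0 ↔ δ' (e x) = 0) : B ≃ₗ[R] B' :=
  (δ.quotKerEquivOfSurjective hδ).symm ≪≫ₗ
    Submodule.Quotient.equiv _ _ e (by
      ext x
      rw [Submodule.mem_map]
      constructor
      · rintro ⟨y, hy, rfl⟩
        exact (h y).1 hy
      · intro hx
        exact ⟨e.symm x, (h _).2 (by simpa using hx), by simp⟩) ≪≫ₗ
    δ'.quotKerEquivOfSurjective hδ'

variable {M K : Type u} [AddCommGroup M] [Module R M] [AddCommGroup K] [Module R K]

/-- Restriction from `Hom(M, N)` to the submodule of the homomorphisms factoring through projectives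
is an isomorphism on `Ext`, as soon as the relevant `Ext` of the stable `Hom` vanish. -/
noncomputable def extRestrictEquiv (i : ℕ) (N : Type u) [AddCommGroup N] [Module R N]
    (h : ∀ j ≤ i + 1, Subsingleton (ExtMod R j (StableHom R M N) K)) :
    ExtMod R i (M →ₗ[R] N) K ≃ₗ[R] ExtMod R i (projectiveHom R M N) K :=
  LinearEquiv.ofBijective (extPre i (projectiveHom R M N).subtype K) <| by
    have h₀ := h i (by lia)
    have h₁ := h (i + 1) le_rfl
    constructor
    · rw [injective_iff_map_eq_zero]
      intro x hx
      obtain ⟨y, rfl⟩ := (extPre_exact (projectiveHom R M N).injective_subtype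
        (LinearMap.exact_subtype_mkQ _) (projectiveHom R M N).mkQ_surjective i x).1 hx
      rw [Subsingleton.elim y 0, map_zero]
    · intro x
      exact (extPre_extPreδ_exact (projectiveHom R M N).injective_subtype
        (LinearMap.exact_subtype_mkQ _) (projectiveHom R M N).mkQ_surjective i x).1
        (Subsingleton.elim _ _)

/-- The isomorphism `Ext^i(Hom^{proj}(M, N), K) ≅ Ext^i(N, Hom(M^*, K))`. -/
theorem nonempty_ext_projectiveHom_equiv [IsNoetherianRing R] [Module.Finite R M] (n : ℕ)
    (hM : ∀ i, 1 ≤ i → i < n → Subsingleton (ExtMod R i (Module.Dual R M) K)) (𝔞 : Ideal R)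
    (h𝔞 : ∀ (S : Type u) [AddCommGroup S] [Module R S] [Module.Finite R S],
      (∀ x ∈ 𝔞, ∀ y : S, x • y = 0) → ∀ i < n, Subsingleton (ExtMod R i S K)) (i : ℕ) :
    i < n → ∀ (N : Type u) [AddCommGroup N] [Module R N] [Module.Finite R N],
      𝔞 ≤ stableIdeal R M ⊔ stableIdeal R N →
      Nonempty (ExtMod R i (projectiveHom R M N) K ≃ₗ[R]
        ExtMod R i N (Module.Dual R M →ₗ[R] K)) := by
  have hstab : ∀ (N : Type u) [AddCommGroup N] [Module R N] [Module.Finite R N],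
      𝔞 ≤ stableIdeal R M ⊔ stableIdeal R N → ∀ j < n,
      Subsingleton (ExtMod R j (StableHom R M N) K) := fun N _ _ _ hN j hj =>
    h𝔞 _ (fun x hx y => smul_stableHom_eq_zero (hN hx) y) j hj
  have base : 0 < n → ∀ (N : Type u) [AddCommGroup N] [Module R N] [Module.Finite R N],
      𝔞 ≤ stableIdeal R M ⊔ stableIdeal R N →
      Function.Bijective (homProjectiveToHom (R := R) M N K) := by
    intro hn N _ _ _ hN
    obtain ⟨N', _, _, b, ι, π, _, hι, hιπ, hπ, hle⟩ := exists_syzygy (R := R) N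
    exact homProjectiveToHom_bijective hι hιπ hπ
      (hstab N' (hN.trans (sup_le_sup_left hle _)) 0 hn)
  induction i with
  | zero =>
    intro hn N _ _ _ hN
    exact ⟨extZero _ _ ≪≫ₗ LinearEquiv.ofBijective _ (base hn N hN) ≪≫ₗ (extZero _ _).symm⟩
  | succ i ih =>
    intro hi N _ _ _ hN
    obtain ⟨N', _, _, b, ι, π, _, hι, hιπ, hπ, hle⟩ := exists_syzygy (R := R) N
    have hN' := hN.trans (sup_le_sup_left hle (stableIdeal R M))
    let res := extRestrictEquiv (M := M) (K := K) i N' fun j hj => hstab N' hN' j (by lia)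
    have hfree : ∀ j, 1 ≤ j → j < n → Subsingleton (ExtMod R j (M →ₗ[R] Fin b → R) K) :=
      fun j h1 h2 => have := hM j h1 h2; subsingleton_ext_hom_free j b
    cases i with
    | succ i =>
      -- In degree at least two both connecting maps are isomorphisms, since the `Ext` of the middle
      -- terms vanish in the two relevant degrees.
      obtain ⟨e⟩ := ih (by lia) N' hN'
      have := hfree (i + 1) (by lia) (by lia)
      have := hfree (i + 1 + 1) (by lia) hi
      have := subsingleton_ext_of_projective (R := R) (A := Fin b → R)
        (Y := Module.Dual R M →ₗ[R] K) i
      have := subsingleton_ext_of_projective (R := R) (A := Fin b → R)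
        (Y := Module.Dual R M →ₗ[R] K) (i + 1)
      exact ⟨(extPreδEquiv (A := M →ₗ[R] N') (B := M →ₗ[R] Fin b → R)
        (C := projectiveHom R M N) (compRight_injective hι) (compProjective_exact hι hιπ)
        (compProjective_surjective π hπ) (i + 1)).symm ≪≫ₗ res ≪≫ₗ e ≪≫ₗ
        extPreδEquiv hι hιπ hπ (i + 1)⟩
    | zero =>
      have := hfree 1 le_rfl hi
      have hF := subsingleton_ext_of_projective (R := R) (A := Fin b → R)
        (Y := Module.Dual R M →ₗ[R] K) 0
      -- In degree one the `Hom` of the middle terms survives, so both `Ext^1` are only cokernels.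
      -- An abstract isomorphism would not do: `e` is explicit so that naturality and
      -- `homHomToHom_surjective` for `R^b` identify the two images.
      let e : ExtMod R 0 (M →ₗ[R] N') K ≃ₗ[R] ExtMod R 0 N' (Module.Dual R M →ₗ[R] K) :=
        res ≪≫ₗ extZero _ _ ≪≫ₗ LinearEquiv.ofBijective _ (base (by lia) N' hN') ≪≫ₗ
          (extZero _ _).symm
      have he : ∀ x, e x = (extZero _ _).symm (homHomToHom M N' K (extZero _ _ x)) := by
        intro x
        change (extZero _ _).symm (homProjectiveToHom M N' K (extZero _ _ (extPre 0 _ K x))) = _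
        rw [extZero_extPre]
        rfl
      have hnat : ∀ y : ExtMod R 0 (M →ₗ[R] Fin b → R) K,
          e (extPre 0 (ι.compRight R) K y) =
            extPre 0 ι _ ((extZero _ _).symm (homHomToHom M _ K (extZero _ _ y))) := by
        intro y
        rw [he, extZero_extPre, homHomToHom_comp, LinearEquiv.symm_apply_eq, extZero_extPre,
          LinearEquiv.apply_symm_apply]
      refine ⟨equivOfSurjective e
        (extPreδ (A := M →ₗ[R] N') (B := M →ₗ[R] Fin b → R)
          (C := projectiveHom R M N) (compRight_injective hι) (compProjective_exact hι hιπ)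
          (compProjective_surjective π hπ) 0 K)
        (extPreδ hι hιπ hπ 0 _)
        (fun x => (extPreδ_extPre_exact _ _ _ 0 x).1 (Subsingleton.elim _ _))
        (fun x => (extPreδ_extPre_exact _ _ _ 0 x).1 (Subsingleton.elim _ _)) fun x => ?_⟩
      rw [extPre_extPreδ_exact (A := M →ₗ[R] N') (B := M →ₗ[R] Fin b → R)
          (C := projectiveHom R M N) (compRight_injective hι) (compProjective_exact hι hιπ)
          (compProjective_surjective π hπ) 0 x, extPre_extPreδ_exact hι hιπ hπ 0 (e x)]
      constructor
      · rintro ⟨y, rfl⟩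
        exact ⟨_, (hnat y).symm⟩
      · rintro ⟨z, hz⟩
        obtain ⟨ψ, rfl⟩ := (extZero _ _).symm.surjective z
        obtain ⟨φ, rfl⟩ := homHomToHom_surjective ψ
        exact ⟨(extZero _ _).symm φ, e.injective (by
          rw [hnat, LinearEquiv.apply_symm_apply]; exact hz)⟩

end Main

end ARDuality

/-! ### Assembly of the exact sequence and the isomorphisms. -/

theorem mainTheorem1 (R : Type u) [CommRing R] [IsNoetherianRing R]
    (M N K : Type u)
    [AddCommGroup M] [Module R M] [Module.Finite R M]
    [AddCommGroup N] [Module R N] [Module.Finite R N]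
    [AddCommGroup K] [Module R K] [Module.Finite R K]
    (n : ℕ) (hn : 1 ≤ n)
    (hM : ARDuality.IsTorsionfreeWrt R (n + 1) M K)
    (hNF : ARDuality.nonfreeLocus R M ∩ ARDuality.nonfreeLocus R N ⊆
      ARDuality.depthGELocus R K n) :
    (∃ (f : ARDuality.ExtMod R (n - 1) (M →ₗ[R] N) K →ₗ[R]
            ARDuality.ExtMod R (n - 1) N (M ⊗[R] K))
        (g : ARDuality.ExtMod R (n - 1) N (M ⊗[R] K) →ₗ[R]
            ARDuality.ExtMod R n (ARDuality.StableHom R M N) K)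
        (h : ARDuality.ExtMod R n (ARDuality.StableHom R M N) K →ₗ[R]
            ARDuality.ExtMod R n (M →ₗ[R] N) K),
        Function.Injective f ∧ Function.Exact f g ∧ Function.Exact g h) ∧
    (∀ i : ℕ, i + 2 ≤ n →
      Nonempty (ARDuality.ExtMod R i (M →ₗ[R] N) K ≃ₗ[R]
        ARDuality.ExtMod R i N (M ⊗[R] K))) := by
  obtain ⟨P, hP⟩ := hM
  let 𝔞 := ARDuality.stableIdeal R M ⊔ ARDuality.stableIdeal R N
  have h𝔞 : ∀ (S : Type u) [AddCommGroup S] [Module R S] [Module.Finite R S],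
      (∀ x ∈ 𝔞, ∀ y : S, x • y = 0) → ∀ i < n, Subsingleton (ARDuality.ExtMod R i S K) :=
    fun S _ _ _ hS i hi => ARDuality.subsingleton_ext_of_le_depth 𝔞 K n
      (fun p hp => hNF ⟨ARDuality.mem_nonfreeLocus_of_stableIdeal_le (le_sup_left.trans hp),
        ARDuality.mem_nonfreeLocus_of_stableIdeal_le (le_sup_right.trans hp)⟩) 𝔞 le_rfl S hS i hi
  have hdual : ∀ i, 1 ≤ i → i < n → Subsingleton (ARDuality.ExtMod R i (Module.Dual R M) K) := by
    intro i h1 h2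
    obtain ⟨i, rfl⟩ := Nat.exists_eq_add_of_le' h1
    -- The degree is now `i + 1 < n`, and the shift by two needs `i + 3 ≤ n + 1`, exactly the range
    -- of the torsionfreeness hypothesis.
    have := hP (i + 3) (by lia) (by lia)
    exact P.subsingleton_ext_dual i
  have hP1 := hP 1 le_rfl (by lia)
  have hP2 := hP 2 (by lia) (by lia)
  let W : (M ⊗[R] K) ≃ₗ[R] (Module.Dual R M →ₗ[R] K) :=
    LinearEquiv.ofBijective _ (ARDuality.tensorToHomDual_bijective P)
  have hstab : ∀ j < n, Subsingleton (ARDuality.ExtMod R j (ARDuality.StableHom R M N) K) :=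
    h𝔞 _ fun _ hx y => ARDuality.smul_stableHom_eq_zero hx y
  have main : ∀ i < n, Nonempty (ARDuality.ExtMod R i (ARDuality.projectiveHom R M N) K ≃ₗ[R]
      ARDuality.ExtMod R i N (M ⊗[R] K)) := fun i hi => by
    obtain ⟨e⟩ := ARDuality.nonempty_ext_projectiveHom_equiv n hdual 𝔞 h𝔞 i hi N le_rfl
    exact ⟨e ≪≫ₗ (ARDuality.extCongrRight i N W).symm⟩
  refine ⟨?_, fun i hi => ?_⟩
  · obtain ⟨m, rfl⟩ := Nat.exists_eq_add_of_le' hn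
    obtain ⟨e⟩ := main m (by lia)
    let I := ARDuality.projectiveHom R M N
    have hex : Function.Exact I.subtype I.mkQ := LinearMap.exact_subtype_mkQ _
    let δ := ARDuality.extPreδ I.injective_subtype hex I.mkQ_surjective m K
    -- The long exact sequence with `Ext^m(I, K)` replaced along `e`; injectivity on the left comes
    -- from `Ext^m(StableHom, K) = 0`.
    refine ⟨e.toLinearMap ∘ₗ ARDuality.extPre m I.subtype K, δ ∘ₗ e.symm.toLinearMap,
      ARDuality.extPre (m + 1) I.mkQ K, e.injective.comp ?_, ?_, ?_⟩
    · rw [injective_iff_map_eq_zero]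
      intro x hx
      obtain ⟨y, rfl⟩ := (ARDuality.extPre_exact I.injective_subtype hex I.mkQ_surjective m x).1 hx
      have := hstab m (by lia)
      rw [Subsingleton.elim y 0, map_zero]
    · intro y
      obtain ⟨x, rfl⟩ := e.surjective y
      have h := ARDuality.extPre_extPreδ_exact I.injective_subtype hex I.mkQ_surjective m (Y := K) x
      simpa [δ] using h
    · intro y
      have h := ARDuality.extPreδ_extPre_exact I.injective_subtype hex I.mkQ_surjective m (Y := K) y
      rw [h]
      constructor
      · rintro ⟨x, rfl⟩
        exact ⟨e x, congrArg δ (e.symm_apply_apply x)⟩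
      · rintro ⟨x, rfl⟩
        exact ⟨e.symm x, rfl⟩
  -- For `i + 2 ≤ n` the stable Hom has no `Ext` in degrees `i` and `i + 1`, so restriction is an
  -- isomorphism.
  · obtain ⟨e⟩ := main i (by lia)
    exact ⟨ARDuality.extRestrictEquiv i N (fun j hj => hstab j (by lia)) ≪≫ₗ e⟩
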